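/- Let $H_1,\dots,H_L$ be Hermitian operators on a finite-dimensional complex Hilbert space, let $\Lambda:=\max_j\|H_j\|$ (spectral norm), let $\lambda\in\mathbb{C}$, and let $k\ge 1$ and $s\ge 0$ be integers. Put $V(\lambda):=\exp\bigl(\lambda\sum_{j=1}^L H_j\bigr)$. For a permutation $\sigma\in\mathrm{Sym}(L)$ define the permuted product formulas by $$S_2^\sigma(\lambda):=\prod_{j=1}^{L}\exp\Bigl(\tfrac{\lambda}{2}H_{\sigma(j)}\Bigr)\prod_{j=L}^{1}\exp\Bigl(\tfrac{\lambda}{2}H_{\sigma(j)}\Bigr),$$ $$S_{2k}^\sigma(\lambda):=[S_{2k-2}^\sigma(p_k\lambda)]^2\,S_{2k-2}^\sigma((1-4p_k)\lambda)\,[S_{2k-2}^\sigma(p_k\lambda)]^2,\qquad p_k:=\frac{1}{4-4^{1/(2k-1)}}\quad(k>1).$$ Then $f(\lambda):=V(\lambda)-\frac{1}{L!}\sum_{\sigma\in\mathrm{Sym}(L)}S_{2k}^\sigma(\lambda)$ is an entire operator-valued function of $\lambda$, and the $s$th-order term $\frac{\lambda^s}{s!}f^{(s)}(0)$ of its Taylor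 expansion at $0$ vanishes if $0\le s\le 2k$, and satisfies $$\Bigl\|\frac{\lambda^s}{s!}f^{(s)}(0)\Bigr\|\le\frac{(2\cdot 5^{k-1}\Lambda|\lambda|)^s}{(s-2)!}\,L^{s-1}\qquad\text{if } s>2k.$$ -/

import Mathlib

open scoped Nat

noncomputable section

namespace ProductFormula

variable {E : Type*} [NormedAddCommGroup E] [InnerProductSpace ℂ E]

/-- The target evolution `V(z) = exp (z ∑ j, H_j)`. -/
def evolution {L : ℕ} (H : Fin L → E →L[ℂ] E) (z : ℂ) : E →L[ℂ] E :=
  NormedSpace.exp (z • ∑ j, H j)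

/-- Suzuki's coefficient `p_k = 1 / (4 - 4 ^ (1 / (2k - 1)))`, used for `k ≥ 2`. -/
def suzukiCoeff (k : ℕ) : ℝ :=
  1 / (4 - (4 : ℝ) ^ (1 / (2 * (k : ℝ) - 1)))

/-- The second-order formula with the summands in the order given by `σ`: the product over
`j = 1, …, L` followed by the product over `j = L, …, 1` of `exp ((z / 2) H_{σ(j)})`. -/
def secondOrder {L : ℕ} (H : Fin L → E →L[ℂ] E) (σ : Equiv.Perm (Fin L)) (z : ℂ) :
    E →L[ℂ] E :=
  (List.ofFn fun j => NormedSpace.exp ((z / 2) • H (σ j))).prod *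
    (List.ofFn fun j => NormedSpace.exp ((z / 2) • H (σ j))).reverse.prod

/-- `suzuki H σ k z` is the permuted `(2k)`th-order product formula `S_{2k}^σ(z)`, for `k ≥ 1`.
The value at `k = 0` is a placeholder that no other case uses. -/
def suzuki {L : ℕ} (H : Fin L → E →L[ℂ] E) (σ : Equiv.Perm (Fin L)) :
    ℕ → ℂ → E →L[ℂ] E
  | 0, _ => 1
  | 1, z => secondOrder H σ z
  | k + 2, z =>
      suzuki H σ (k + 1) ((suzukiCoeff (k + 2) : ℂ) * z) ^ 2 *
        suzuki H σ (k + 1) ((1 - 4 * (suzukiCoeff (k + 2) : ℂ)) * z) *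
        suzuki H σ (k + 1) ((suzukiCoeff (k + 2) : ℂ) * z) ^ 2

/-- The difference `V(z) - (1 / L!) ∑ σ, S_{2k}^σ(z)` between the target evolution and the
average of the permuted formulas over all orderings of the summands. -/
def averageError {L : ℕ} (H : Fin L → E →L[ℂ] E) (k : ℕ) (z : ℂ) : E →L[ℂ] E :=
  evolution H z - ((L ! : ℂ)⁻¹) • ∑ σ : Equiv.Perm (Fin L), suzuki H σ k z

/-- The `s`th-order term `(z ^ s / s!) f⁽ˢ⁾(0)` of the Taylor expansion of `f` at `0`. -/
def taylorTerm {F : Type*} [NormedAddCommGroup F] [NormedSpace ℂ F]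
    (f : ℂ → F) (s : ℕ) (z : ℂ) : F :=
  (z ^ s / (s ! : ℂ)) • iteratedDeriv s f 0

end ProductFormula

end

/-!
The evolution and every permuted product formula are sums of everywhere convergent power series
whose coefficients are noncommutative polynomials in the summands `H_j`. The argument therefore
works with formal power series over a noncommutative algebra (`formulaSeries`) and returns to
functions only at the end (`HasEntireSeries`).

*Vanishing through order `2k`.* This is Suzuki's order condition (`eqToOrder_suzukiFactors`), valid
for each ordering separately. In the recursion the leading error of `S_{2k-2}` gets multiplied by
`4 p_k ^ (2k-1) + (1 - 4 p_k) ^ (2k-1)`, which is zero by the choice of `p_k`. The list of factors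
of `S_{2k}` is a palindrome, so `S_{2k}(z) S_{2k}(-z) = 1`, and this forces the leading error to
have odd order (`EqToOrder.eq_zero_of_even`); hence one step gains two orders.

*The bound.* The coefficient of `z ^ s` in a product formula is a sum over words of length `s` in
the letters `H_j`, with scalar coefficients `wordCoeff` that depend on the list of factors only. In
the average over all orderings, a word without repeated letters has coefficient exactly `1 / s!`, as
in the evolution (`sum_perm_wordCoeff`): the average does not depend on which such word is taken,
and the sum over all of them is an elementary symmetric function of the total weights of the
letters, which are all `1` (`sum_wordCoeff_injective`). So only words with a repeated letter
contribute to the error. There are at most `s.choose 2 * L ^ (s - 1)` of these, each of norm at most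
`Λ ^ s`. Majorizing all coefficients of the factors by `1` turns the formula into one in which each
letter has weight `m = 2 * 5 ^ (k - 1)`, and the same count shows that the repeated words carry
total weight at most `m ^ s / s! * s.choose 2 * L ^ (s - 1)` (`norm_average_error_coeff_le`).
-/

noncomputable section

namespace ProductFormula

/-! ### Exponential series and their ordered products -/

section Formal

variable {K B ι : Type*} [Field K] [Ring B] [Algebra K B]

/-- The formal exponential `exp (X a) = ∑ n, (a ^ n / n!) X ^ n`. The ring of coefficients need not
be commutative; the variable `X` is central. -/
def expSeries (K : Type*) {B : Type*} [Field K] [Ring B] [Algebra K B] (a : B) : PowerSeries B :=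
  PowerSeries.mk fun n => ((n ! : K)⁻¹) • a ^ n

/-- The substitution `X ↦ q X`, as a monoid homomorphism. (`PowerSeries.rescale` is restricted to
commutative coefficient rings.) -/
def dilate (q : K) : PowerSeries B →* PowerSeries B where
  toFun f := PowerSeries.mk fun n => q ^ n • PowerSeries.coeff n f
  map_one' := by
    ext n
    rw [PowerSeries.coeff_mk, PowerSeries.coeff_one]
    split_ifs with h <;> simp [h]
  map_mul' f g := by
    ext n
    simp only [PowerSeries.coeff_mk, PowerSeries.coeff_mul, Finset.smul_sum]
    refine Finset.sum_congr rfl fun p hp => ?_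
    rw [Finset.HasAntidiagonal.mem_antidiagonal] at hp
    rw [smul_mul_smul_comm, ← pow_add, hp]

/-- The formal counterpart of the product of the exponentials `exp (q z H_j)` over the pairs
`(q, j)` of a list, in the order of the list. -/
def formulaSeries (H : ι → B) (W : List (K × ι)) : PowerSeries B :=
  (W.map fun p => expSeries K (p.1 • H p.2)).prod

/-- Multiplication of all the coefficients of a list of factors by `q`. -/
def scaleFactors (q : K) (W : List (K × ι)) : List (K × ι) :=
  W.map fun p => (q * p.1, p.2)

@[simp]
theorem coeff_expSeries (a : B) (n : ℕ) :
    PowerSeries.coeff n (expSeries K a) = ((n ! : K)⁻¹) • a ^ n :=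
  PowerSeries.coeff_mk _ _

@[simp]
theorem coeff_dilate (q : K) (f : PowerSeries B) (n : ℕ) :
    PowerSeries.coeff n (dilate q f) = q ^ n • PowerSeries.coeff n f := by
  change PowerSeries.coeff n (PowerSeries.mk fun n => q ^ n • PowerSeries.coeff n f) = _
  rw [PowerSeries.coeff_mk]

theorem expSeries_zero : expSeries K (0 : B) = 1 := by
  ext n
  rcases n with _ | n <;> simp [PowerSeries.coeff_one]

theorem dilate_expSeries (q : K) (a : B) :
    dilate q (expSeries K a) = expSeries K (q • a) := by
  ext n
  rw [coeff_dilate, coeff_expSeries, coeff_expSeries, smul_pow, smul_comm]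

@[simp]
theorem formulaSeries_nil (H : ι → B) : formulaSeries H ([] : List (K × ι)) = 1 := rfl

theorem formulaSeries_cons (H : ι → B) (p : K × ι) (W : List (K × ι)) :
    formulaSeries H (p :: W) = expSeries K (p.1 • H p.2) * formulaSeries H W := by
  simp [formulaSeries]

theorem formulaSeries_append (H : ι → B) (W W' : List (K × ι)) :
    formulaSeries H (W ++ W') = formulaSeries H W * formulaSeries H W' := by
  simp [formulaSeries]

theorem formulaSeries_scaleFactors (H : ι → B) (q : K) (W : List (K × ι)) :
    formulaSeries H (scaleFactors q W) = dilate q (formulaSeries H W) := by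
  rw [formulaSeries, formulaSeries, map_list_prod, scaleFactors, List.map_map, List.map_map]
  simp [Function.comp_def, dilate_expSeries, smul_smul]

theorem expSeries_mul_expSeries [CharZero K] (a b : K) (x : B) :
    expSeries K (a • x) * expSeries K (b • x) = expSeries K ((a + b) • x) := by
  ext n
  rw [PowerSeries.coeff_mul, coeff_expSeries, smul_pow, (Commute.all a b).add_pow', Finset.sum_smul,
    Finset.smul_sum]
  refine Finset.sum_congr rfl fun p hp => ?_
  rw [Finset.HasAntidiagonal.mem_antidiagonal] at hp
  subst hp
  rw [coeff_expSeries, coeff_expSeries, smul_pow, smul_pow, smul_smul, smul_smul,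
    smul_mul_smul_comm, ← pow_add, ← Nat.cast_smul_eq_nsmul K, smul_eq_mul, smul_smul]
  congr 1
  rw [Nat.cast_add_choose]
  have h1 : (p.1 ! : K) ≠ 0 := by exact_mod_cast p.1.factorial_ne_zero
  have h2 : (p.2 ! : K) ≠ 0 := by exact_mod_cast p.2.factorial_ne_zero
  have h3 : ((p.1 + p.2) ! : K) ≠ 0 := by exact_mod_cast (p.1 + p.2).factorial_ne_zero
  field_simp

theorem formulaSeries_mul_reverse_neg [CharZero K] (H : ι → B) (W : List (K × ι)) :
    formulaSeries H W * formulaSeries H (scaleFactors (-1) W).reverse = 1 := by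
  induction W with
  | nil => simp [scaleFactors]
  | cons p W ih =>
    have h : formulaSeries H [((-1 : K) * p.1, p.2)] = expSeries K ((-1 * p.1) • H p.2) := by
      simp [formulaSeries]
    rw [scaleFactors, List.map_cons, List.reverse_cons, formulaSeries_append, formulaSeries_cons,
      h, mul_assoc, ← mul_assoc (formulaSeries H W)]
    rw [scaleFactors] at ih
    rw [ih, one_mul, expSeries_mul_expSeries]
    simp [expSeries_zero]

/-- A product formula whose list of factors is a palindrome satisfies `S(X) S(-X) = 1`. -/
theorem formulaSeries_mul_dilate_neg [CharZero K] (H : ι → B) {W : List (K × ι)}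
    (hW : W.reverse = W) :
    formulaSeries H W * dilate (-1 : K) (formulaSeries H W) = 1 := by
  have h := formulaSeries_mul_reverse_neg H W
  rwa [scaleFactors, ← List.map_reverse, hW, ← scaleFactors, formulaSeries_scaleFactors] at h

/-! ### Order conditions -/

/-- `EqToOrder n f v r` says that `f` and `v` have constant coefficient `1` and that
`f = v + r X ^ n` modulo `X ^ (n + 1)`. -/
structure EqToOrder (n : ℕ) (f v : PowerSeries B) (r : B) : Prop where
  pos : 0 < n
  left_one : PowerSeries.coeff 0 f = 1
  right_one : PowerSeries.coeff 0 v = 1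
  lower : ∀ m < n, PowerSeries.coeff m f = PowerSeries.coeff m v
  leading : PowerSeries.coeff n f = PowerSeries.coeff n v + r

namespace EqToOrder

variable {n : ℕ} {f g v u : PowerSeries B} {r t : B}

/-- Leading errors add up in products. -/
theorem mul (hf : EqToOrder n f v r) (hg : EqToOrder n g u t) :
    EqToOrder n (f * g) (v * u) (r + t) where
  pos := hf.pos
  left_one := by simp [PowerSeries.coeff_mul, hf.left_one, hg.left_one]
  right_one := by simp [PowerSeries.coeff_mul, hf.right_one, hg.right_one]
  lower m hm := by
    rw [PowerSeries.coeff_mul, PowerSeries.coeff_mul]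
    refine Finset.sum_congr rfl fun p hp => ?_
    rw [Finset.HasAntidiagonal.mem_antidiagonal] at hp
    rw [hf.lower _ (by omega), hg.lower _ (by omega)]
  leading := by
    rw [PowerSeries.coeff_mul, PowerSeries.coeff_mul]
    obtain ⟨m, rfl⟩ : ∃ m, n = m + 1 := ⟨n - 1, by have := hf.pos; omega⟩
    rw [Finset.Nat.antidiagonal_succ, Finset.sum_cons, Finset.sum_cons, Finset.sum_map,
      Finset.sum_map]
    cases m with
    | zero =>
      simp [hf.left_one, hf.right_one, hg.left_one, hg.right_one, hf.leading, hg.leading]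
      abel
    | succ m =>
      rw [Finset.Nat.antidiagonal_succ', Finset.sum_cons, Finset.sum_cons, Finset.sum_map,
        Finset.sum_map]
      have hmid : ∀ p ∈ Finset.HasAntidiagonal.antidiagonal m,
          PowerSeries.coeff (p.1 + 1) f * PowerSeries.coeff (p.2 + 1) g =
            PowerSeries.coeff (p.1 + 1) v * PowerSeries.coeff (p.2 + 1) u := fun p hp => by
        rw [Finset.HasAntidiagonal.mem_antidiagonal] at hp
        rw [hf.lower _ (by omega), hg.lower _ (by omega)]
      have hsum := Finset.sum_congr rfl hmid
      simp only [Function.Embedding.prodMap, Function.Embedding.coeFn_mk, Prod.map,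
        Function.Embedding.refl_apply, Nat.succ_eq_add_one] at hsum ⊢
      rw [hsum, hf.left_one, hf.right_one, hg.left_one, hg.right_one, hf.leading, hg.leading]
      simp only [one_mul, mul_one]
      abel

theorem dilate (hf : EqToOrder n f v r) (q : K) :
    EqToOrder n (dilate q f) (dilate q v) (q ^ n • r) where
  pos := hf.pos
  left_one := by simp [hf.left_one]
  right_one := by simp [hf.right_one]
  lower m hm := by simp [hf.lower m hm]
  leading := by simp [hf.leading]

theorem succ (hf : EqToOrder n f v 0) :
    EqToOrder (n + 1) f v (PowerSeries.coeff (n + 1) f - PowerSeries.coeff (n + 1) v) where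
  pos := n.succ_pos
  left_one := hf.left_one
  right_one := hf.right_one
  lower m hm := by
    rcases Nat.lt_succ_iff_lt_or_eq.1 hm with h | rfl
    · exact hf.lower m h
    · simpa using hf.leading
  leading := by simp

/-- For `S(X) S(-X) = 1` the order of approximation of an exponential is even: the leading error
`r X ^ n` satisfies `r + (-1) ^ n r = 0`. -/
theorem eq_zero_of_even [CharZero K] {A : B} (hf : EqToOrder n f (expSeries K A) r) (hn : Even n)
    (hsym : f * ProductFormula.dilate (-1 : K) f = 1) : r = 0 := by
  have h := (hf.mul (hf.dilate (-1 : K))).leading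
  have hexp : expSeries K A * expSeries K ((-1 : K) • A) = 1 := by
    simpa [expSeries_zero] using expSeries_mul_expSeries (1 : K) (-1) A
  rw [hsym, dilate_expSeries, hexp, hn.neg_one_pow, one_smul, left_eq_add, ← two_smul K] at h
  exact (smul_eq_zero.1 h).resolve_left two_ne_zero

end EqToOrder

theorem eqToOrder_formulaSeries_one (H : ι → B) (W : List (K × ι)) :
    EqToOrder 1 (formulaSeries H W) 1 (W.map fun p => p.1 • H p.2).sum := by
  induction W with
  | nil => exact ⟨one_pos, by simp, by simp, fun _ _ => rfl, by simp⟩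
  | cons p W ih =>
    have h : EqToOrder 1 (expSeries K (p.1 • H p.2)) 1 (p.1 • H p.2) :=
      ⟨one_pos, by simp, by simp, fun m hm => by
        obtain rfl : m = 0 := by omega
        simp, by simp [PowerSeries.coeff_one]⟩
    rw [formulaSeries_cons, List.map_cons, List.sum_cons]
    simpa using h.mul ih

/-- One step of Suzuki's recursion. If `S` is symmetric and agrees with `exp (X A)` through order
`2k`, and `4 p ^ (2k+1) + (1 - 4p) ^ (2k+1) = 0`, then the order `2k+1` errors of the five factors
cancel, and the order `2k+2` error vanishes because the composition is again symmetric. -/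
theorem EqToOrder.suzukiStep [CharZero K] {k : ℕ} {W : List (K × ι)} {H : ι → B} {A r : B} {p : K}
    (h : EqToOrder (2 * k + 1) (formulaSeries H W) (expSeries K A) r) (hW : W.reverse = W)
    (hp : 4 * p ^ (2 * k + 1) + (1 - 4 * p) ^ (2 * k + 1) = 0) :
    ∃ r', EqToOrder (2 * (k + 1) + 1)
      (formulaSeries H (scaleFactors p W ++ scaleFactors p W ++ scaleFactors (1 - 4 * p) W ++
        scaleFactors p W ++ scaleFactors p W)) (expSeries K A) r' := by
  have hp' := h.dilate p
  have hm := (((hp'.mul hp').mul (h.dilate (1 - 4 * p))).mul hp').mul hp'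
  simp only [dilate_expSeries, expSeries_mul_expSeries, ← formulaSeries_scaleFactors,
    ← formulaSeries_append] at hm
  have h1 : p + p + (1 - 4 * p) + p + p = 1 := by ring
  have h2 : p ^ (2 * k + 1) + p ^ (2 * k + 1) + (1 - 4 * p) ^ (2 * k + 1) + p ^ (2 * k + 1) +
      p ^ (2 * k + 1) = 0 := by linear_combination hp
  rw [h1, one_smul, ← add_smul, ← add_smul, ← add_smul, ← add_smul, h2, zero_smul] at hm
  have hs := hm.succ
  have hz := hs.eq_zero_of_even ⟨k + 1, by ring⟩ (formulaSeries_mul_dilate_neg H (by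
    simp only [List.reverse_append, scaleFactors, ← List.map_reverse, hW, List.append_assoc]))
  rw [hz] at hs
  exact ⟨_, hs.succ⟩

end Formal

/-! ### Expansion of product formulas into words -/

section Words

variable {K ι : Type*} [Field K] [DecidableEq ι]

/-- The scalar coefficient of the word `w` in the expansion of the product formula with list of
factors `W` as a series in noncommuting letters. The first factor `exp (q X_j)` consumes a prefix
`j ⋯ j` of the word, of length `n` and with weight `q ^ n / n!`. -/
def wordCoeff : List (K × ι) → List ι → K
  | [], w => if w = [] then 1 else 0
  | (q, j) :: W, w => ∑ n ∈ Finset.range (w.length + 1),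
      if w.take n = List.replicate n j then (n ! : K)⁻¹ * q ^ n * wordCoeff W (w.drop n) else 0

/-- The sum of the coefficients of the factors that carry the letter `i`. -/
def letterWeight (W : List (K × ι)) (i : ι) : K :=
  (W.map fun p => if p.2 = i then p.1 else 0).sum

theorem coeff_formulaSeries {B : Type*} [Ring B] [Algebra K B] [Fintype ι] (H : ι → B)
    (W : List (K × ι)) (s : ℕ) :
    PowerSeries.coeff s (formulaSeries H W) =
      ∑ w : Fin s → ι, wordCoeff W (List.ofFn w) • (List.ofFn fun i => H (w i)).prod := by
  induction W generalizing s with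
  | nil =>
    rcases s with _ | s
    · simp [wordCoeff]
    · simp [wordCoeff, PowerSeries.coeff_one]
  | cons p W ih =>
    obtain ⟨q, j⟩ := p
    rw [formulaSeries_cons, PowerSeries.coeff_mul, Finset.Nat.sum_antidiagonal_eq_sum_range_succ_mk]
    simp only [wordCoeff, Finset.sum_smul, List.length_ofFn]
    rw [Finset.sum_comm]
    refine Finset.sum_congr rfl fun n hn => ?_
    obtain ⟨m, rfl⟩ : ∃ m, s = n + m :=
      Nat.exists_eq_add_of_le (by simpa [Nat.lt_succ_iff] using hn)
    rw [Nat.add_sub_cancel_left, ih, ← (Fin.appendEquiv n m).sum_comp, Fintype.sum_prod_type]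
    have happ : ∀ (u : Fin n → ι) (v : Fin m → ι), (List.ofFn fun i => H (Fin.append u v i)) =
        (List.ofFn fun i => H (u i)) ++ List.ofFn fun i => H (v i) := fun u v => by
      rw [← List.ofFn_fin_append]
      congr 1
      funext i
      exact Fin.addCases (by simp) (by simp) i
    have hequiv : ∀ (u : Fin n → ι) (v : Fin m → ι),
        Fin.appendEquiv n m (u, v) = Fin.append u v := fun _ _ => rfl
    symm
    rw [Finset.sum_eq_single (fun _ : Fin n => j)]
    · rw [coeff_expSeries, Finset.mul_sum]
      refine Finset.sum_congr rfl fun v _ => ?_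
      rw [hequiv, happ, List.ofFn_fin_append, List.take_left' (by simp), List.drop_left' (by simp)]
      simp only [if_true, List.ofFn_const, List.prod_append, List.prod_replicate, smul_pow,
        smul_smul, mul_smul_comm, smul_mul_assoc]
      congr 1
      ring
    · intro u _ hu
      refine Finset.sum_eq_zero fun v _ => ?_
      rw [hequiv, List.ofFn_fin_append, List.take_left' (by simp), if_neg, zero_smul]
      rw [← List.ofFn_const]
      exact fun h => hu (List.ofFn_injective h)
    · simp

/-- Replacing all coefficients, of modulus at most `1`, by `1` majorizes every word coefficient. -/
theorem norm_wordCoeff_le {W : List (ℂ × ι)} (hW : ∀ p ∈ W, ‖p.1‖ ≤ 1) (w : List ι) :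
    ‖wordCoeff W w‖ ≤ wordCoeff (W.map fun p => ((1 : ℝ), p.2)) w := by
  induction W generalizing w with
  | nil =>
    simp only [wordCoeff, List.map_nil]
    split_ifs <;> simp
  | cons p W ih =>
    obtain ⟨q, j⟩ := p
    simp only [wordCoeff, List.map_cons]
    refine (norm_sum_le _ _).trans (Finset.sum_le_sum fun n _ => ?_)
    split_ifs
    · have h := ih (fun p hp => hW p (List.mem_cons_of_mem _ hp)) (w.drop n)
      have hq : ‖q‖ ^ n ≤ 1 := pow_le_one₀ (norm_nonneg _) (hW (q, j) List.mem_cons_self)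
      rw [norm_mul, norm_mul, norm_inv, norm_pow, RCLike.norm_natCast, one_pow]
      gcongr
    · simp

/-- The total weight of the words of length `s`, found by substituting `1` for every letter. -/
theorem sum_wordCoeff_one [Fintype ι] (W : List ι) (s : ℕ) :
    ∑ w : Fin s → ι, wordCoeff (W.map fun j => ((1 : ℝ), j)) (List.ofFn w) =
      (W.length : ℝ) ^ s / s ! := by
  have h := coeff_formulaSeries (fun _ : ι => (1 : ℝ)) (W.map fun j => ((1 : ℝ), j)) s
  have hexp : formulaSeries (fun _ : ι => (1 : ℝ)) (W.map fun j => ((1 : ℝ), j)) =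
      expSeries ℝ ((W.length : ℝ) • (1 : ℝ)) := by
    clear h
    induction W with
    | nil => simp [expSeries_zero]
    | cons j W ih =>
      rw [List.map_cons, formulaSeries_cons, ih, expSeries_mul_expSeries]
      simp [add_comm]
  rw [hexp, coeff_expSeries] at h
  simp only [List.ofFn_const, List.prod_replicate, one_pow, smul_eq_mul, mul_one] at h
  rw [← h]
  ring

/-! ### Words without repeated letters -/

theorem wordCoeff_cons_of_nodup (q : K) (j : ι) (W : List (K × ι)) {a : ι} {w : List ι}
    (h : (a :: w).Nodup) :
    wordCoeff ((q, j) :: W) (a :: w) =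
      wordCoeff W (a :: w) + if a = j then q * wordCoeff W w else 0 := by
  rw [wordCoeff, List.length_cons, Finset.sum_range_succ', Finset.sum_range_succ',
    Finset.sum_eq_zero]
  · simp [add_comm]
  · intro n hn
    refine if_neg fun he => ?_
    have hd : ((a :: w).take (n + 1 + 1)).Nodup := h.sublist (List.take_sublist _ _)
    rw [he, List.nodup_replicate] at hd
    omega

/-- The coefficients of the repetition-free words of length `s` over the letters in `T` add up to
the `s`th elementary symmetric function of the letter weights. It is encoded here as a coefficient
of a generating polynomial, for which adding a factor to the formula is one multiplication. -/
theorem sum_wordCoeff_injective [Fintype ι] (W : List (K × ι)) (s : ℕ) (T : Finset ι) :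
    ∑ w : Fin s → ι, (if Function.Injective w ∧ ∀ i, w i ∈ T then wordCoeff W (List.ofFn w)
      else 0) =
      (∏ i ∈ T, (1 + Polynomial.C (letterWeight W i) * Polynomial.X)).coeff s := by
  induction W generalizing s T with
  | nil =>
    rcases s with _ | s
    · simp [wordCoeff, letterWeight, Function.injective_of_subsingleton]
    · simp [wordCoeff, letterWeight, Polynomial.coeff_one]
  | cons p W ih =>
    obtain ⟨q, j⟩ := p
    rcases s with _ | s
    · have h := ih 0 T
      simp [wordCoeff, Function.injective_of_subsingleton, Polynomial.coeff_zero_prod] at h ⊢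
      exact h
    have hrec : ∀ w : Fin (s + 1) → ι,
        (if Function.Injective w ∧ ∀ i, w i ∈ T then wordCoeff ((q, j) :: W) (List.ofFn w)
          else 0) =
        (if Function.Injective w ∧ ∀ i, w i ∈ T then wordCoeff W (List.ofFn w) else 0) +
        if Function.Injective w ∧ (∀ i, w i ∈ T) ∧ w 0 = j then
          q * wordCoeff W (List.ofFn fun i : Fin s => w i.succ) else 0 := fun w => by
      by_cases hw : Function.Injective w ∧ ∀ i, w i ∈ T
      · have hnd : (List.ofFn w).Nodup := List.nodup_ofFn.2 hw.1
        rw [if_pos hw, if_pos hw]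
        rw [List.ofFn_succ] at hnd ⊢
        rw [wordCoeff_cons_of_nodup _ _ _ hnd]
        simp [hw.1, hw.2]
      · rw [if_neg hw, if_neg hw, if_neg fun h => hw ⟨h.1, h.2.1⟩, add_zero]
    simp only [hrec, Finset.sum_add_distrib]
    rw [ih]
    have hweight : ∀ i, letterWeight ((q, j) :: W) i =
        letterWeight W i + if j = i then q else 0 := fun i => by simp [letterWeight, add_comm]
    by_cases hj : j ∈ T
    · rw [← Finset.mul_prod_erase T _ hj, ← Finset.mul_prod_erase T _ hj]
      have herase : ∏ i ∈ T.erase j,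
          (1 + Polynomial.C (letterWeight ((q, j) :: W) i) * Polynomial.X) =
          ∏ i ∈ T.erase j, (1 + Polynomial.C (letterWeight W i) * Polynomial.X) :=
        Finset.prod_congr rfl fun i hi => by
          rw [hweight, if_neg (Finset.ne_of_mem_erase hi).symm, add_zero]
      have hsplit : ∀ P : Polynomial K,
          (1 + Polynomial.C (letterWeight ((q, j) :: W) j) * Polynomial.X) * P =
            (1 + Polynomial.C (letterWeight W j) * Polynomial.X) * P +
              Polynomial.C q * P * Polynomial.X := fun P => by
        rw [hweight, if_pos rfl, Polynomial.C_add]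
        ring
      rw [herase, hsplit, Polynomial.coeff_add, Polynomial.coeff_mul_X, Polynomial.coeff_C_mul,
        ← ih, Finset.mul_sum]
      congr 1
      rw [← (Fin.consEquiv fun _ => ι).sum_comp, Fintype.sum_prod_type, Finset.sum_eq_single j]
      · refine Finset.sum_congr rfl fun v _ => ?_
        simp only [Fin.consEquiv, Equiv.coe_fn_mk, Fin.cons_zero, Fin.cons_succ, mul_ite, mul_zero,
          Fin.cons_injective_iff, Fin.forall_fin_succ, Finset.mem_erase, Set.mem_range, not_exists]
        refine if_congr ?_ rfl rfl
        constructor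
        · rintro ⟨⟨h1, h2⟩, ⟨-, h3⟩, -⟩
          exact ⟨h2, fun i => ⟨h1 i, h3 i⟩⟩
        · rintro ⟨h1, h2⟩
          exact ⟨⟨fun i => (h2 i).1, h1⟩, ⟨hj, fun i => (h2 i).2⟩, trivial⟩
      · intro a _ ha
        exact Finset.sum_eq_zero fun v _ => if_neg fun h => ha h.2.2
      · simp
    · rw [Finset.sum_eq_zero fun w _ => if_neg ?_, add_zero]
      · congr 1
        refine Finset.prod_congr rfl fun i hi => ?_
        rw [hweight, if_neg, add_zero]
        rintro rfl
        exact hj hi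
      · rintro ⟨-, h1, h2⟩
        exact hj (h2 ▸ h1 0)

/-- When all letters have the same weight `Q`, the coefficients of the repetition-free words of
length `s` add up to `(card ι).choose s * Q ^ s`. -/
theorem sum_wordCoeff_injective_of_weight [Fintype ι] {W : List (K × ι)} {Q : K}
    (hQ : ∀ i, letterWeight W i = Q) (s : ℕ) :
    ∑ w : Fin s → ι with Function.Injective w, wordCoeff W (List.ofFn w) =
      (Fintype.card ι).choose s * Q ^ s := by
  have h := sum_wordCoeff_injective W s Finset.univ
  simp only [hQ, Finset.mem_univ, implies_true, and_true, Finset.prod_const, Finset.card_univ] at h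
  rw [Finset.sum_filter, h]
  have hc : (1 + Polynomial.C Q * Polynomial.X : Polynomial K) ^ Fintype.card ι =
      ((1 + Polynomial.X) ^ Fintype.card ι : Polynomial K).comp
        (Polynomial.C Q * Polynomial.X) := by simp
  rw [hc, Polynomial.comp_C_mul_X_coeff, Polynomial.coeff_one_add_X_pow]

theorem card_injective [Fintype ι] (s : ℕ) :
    (Finset.univ.filter fun w : Fin s → ι => Function.Injective w).card =
      (Fintype.card ι).descFactorial s := by
  rw [← Fintype.card_subtype, Fintype.card_congr (Equiv.subtypeInjectiveEquivEmbedding _ _),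
    Fintype.card_embedding_eq, Fintype.card_fin]

/-- In the average over all relabellings of the letters, a repetition-free word of length `s` has
coefficient `1 / s!` if all letters have weight `1`: the average does not depend on the word, as
permutations act transitively on such words, and its sum over all of them is known. -/
theorem sum_perm_wordCoeff [CharZero K] [Fintype ι] {W : List (K × ι)}
    (hQ : ∀ i, letterWeight W i = 1) {s : ℕ} {w : Fin s → ι} (hw : Function.Injective w) :
    ∑ σ : Equiv.Perm ι, wordCoeff W (List.ofFn fun i => σ (w i)) =
      ((Fintype.card ι) ! : K) * (s ! : K)⁻¹ := by
  have hconst : ∀ v : Fin s → ι, Function.Injective v →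
      ∑ σ : Equiv.Perm ι, wordCoeff W (List.ofFn fun i => σ (v i)) =
        ∑ σ : Equiv.Perm ι, wordCoeff W (List.ofFn fun i => σ (w i)) := fun v hv => by
    obtain ⟨τ, hτ⟩ := Equiv.Perm.exists_extending_pair w v hw hv
    rw [← Equiv.sum_comp (Equiv.mulRight τ) fun σ : Equiv.Perm ι =>
      wordCoeff W (List.ofFn fun i => σ (w i))]
    simp [hτ]
  have hperm : ∀ σ : Equiv.Perm ι,
      ∑ v : Fin s → ι with Function.Injective v, wordCoeff W (List.ofFn fun i => σ (v i)) =
        (Fintype.card ι).choose s := fun σ => by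
    have h := sum_wordCoeff_injective_of_weight hQ s
    rw [one_pow, mul_one] at h
    rw [← h, Finset.sum_filter, Finset.sum_filter]
    exact Fintype.sum_equiv (Equiv.arrowCongr (Equiv.refl (Fin s)) σ) _ _ fun v =>
      if_congr (σ.injective.of_comp_iff v).symm rfl rfl
  -- Summing over all repetition-free words and all relabellings in both orders.
  have hdouble := Finset.sum_comm
    (s := Finset.univ.filter fun v : Fin s → ι => Function.Injective v)
    (t := (Finset.univ : Finset (Equiv.Perm ι)))
    (f := fun v σ => wordCoeff W (List.ofFn fun i => σ (v i)))
  rw [Finset.sum_congr rfl fun v hv => hconst v (Finset.mem_filter.1 hv).2, Finset.sum_const,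
    Finset.sum_congr rfl fun σ _ => hperm σ, Finset.sum_const, card_injective, Finset.card_univ,
    Fintype.card_perm, nsmul_eq_mul, nsmul_eq_mul, Nat.descFactorial_eq_factorial_mul_choose,
    Nat.cast_mul] at hdouble
  have hle : s ≤ Fintype.card ι := by simpa using Fintype.card_le_of_injective w hw
  have h1 : (s ! : K) ≠ 0 := by exact_mod_cast s.factorial_ne_zero
  have h2 : ((Fintype.card ι).choose s : K) ≠ 0 := by exact_mod_cast (Nat.choose_pos hle).ne'
  rw [eq_mul_inv_iff_mul_eq₀ h1]
  apply mul_right_cancel₀ h2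
  linear_combination hdouble

end Words

/-! ### The contribution of words with repeated letters -/

section Bound

variable {ι : Type*} [Fintype ι]

/-- The number of words of length `s` over `L` letters that repeat a letter is at most
`s.choose 2 * L ^ (s - 1)`, as there are `s.choose 2` pairs of positions that can carry
the same letter. -/
theorem pow_sub_descFactorial_le (L s : ℕ) :
    (L : ℝ) ^ s - L.descFactorial s ≤ s * (s - 1) / 2 * (L : ℝ) ^ (s - 1) := by
  induction s with
  | zero => simp
  | succ s ih =>
    have hsub : (L : ℝ) - s ≤ ((L - s : ℕ) : ℝ) := by
      rw [sub_le_iff_le_add]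
      exact_mod_cast (show L ≤ L - s + s by omega)
    have hd : (L.descFactorial s : ℝ) ≤ (L : ℝ) ^ s := by
      exact_mod_cast Nat.descFactorial_le_pow L s
    have hd0 : (0 : ℝ) ≤ L.descFactorial s := Nat.cast_nonneg _
    have hL : (0 : ℝ) ≤ L := Nat.cast_nonneg _
    have hs : (0 : ℝ) ≤ s := Nat.cast_nonneg _
    have hpow : (s : ℝ) * (s - 1) / 2 * (L : ℝ) ^ (s - 1) * L =
        s * (s - 1) / 2 * (L : ℝ) ^ s := by
      rcases s with _ | s
      · simp
      · simp [pow_succ, mul_assoc]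
    rw [Nat.descFactorial_succ, pow_succ]
    push_cast
    have h1 := mul_le_mul_of_nonneg_right hsub hd0
    have h2 := mul_le_mul_of_nonneg_right ih hL
    have h3 := mul_le_mul_of_nonneg_left hd hs
    rw [hpow] at h2
    nlinarith

/-- The power of a sum expanded into words. -/
theorem sum_pow_eq_sum_words {B : Type*} [Ring B] [Algebra ℂ B] (H : ι → B) (s : ℕ) :
    (∑ j, H j) ^ s = ∑ w : Fin s → ι, (List.ofFn fun i => H (w i)).prod := by
  have h := (MultilinearMap.mkPiAlgebraFin ℂ s B).map_sum fun (_ : Fin s) (j : ι) => H j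
  simpa [MultilinearMap.mkPiAlgebraFin_apply, List.ofFn_const] using h

/-- The `s`th coefficient of the averaged error, expanded into words. Relabelling the letters of the
formula is moved from the operators to the word coefficients. -/
theorem average_error_coeff [DecidableEq ι] {B : Type*} [Ring B] [Algebra ℂ B] (H : ι → B)
    (W : List (ℂ × ι)) (s : ℕ) :
    (s ! : ℂ)⁻¹ • (∑ j, H j) ^ s - (((Fintype.card ι) ! : ℂ)⁻¹) •
        ∑ σ : Equiv.Perm ι, PowerSeries.coeff s (formulaSeries (fun j => H (σ j)) W) =
      ∑ w : Fin s → ι, ((s ! : ℂ)⁻¹ - ((Fintype.card ι) ! : ℂ)⁻¹ *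
        ∑ σ : Equiv.Perm ι, wordCoeff W (List.ofFn fun i => σ (w i))) •
          (List.ofFn fun i => H (w i)).prod := by
  have hσ : ∑ σ : Equiv.Perm ι, PowerSeries.coeff s (formulaSeries (fun j => H (σ j)) W) =
      ∑ w : Fin s → ι, (∑ σ : Equiv.Perm ι, wordCoeff W (List.ofFn fun i => σ (w i))) •
        (List.ofFn fun i => H (w i)).prod := by
    simp only [Finset.sum_smul]
    rw [Finset.sum_comm, ← Equiv.sum_comp (Equiv.inv (Equiv.Perm ι))]
    refine Finset.sum_congr rfl fun σ _ => ?_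
    rw [coeff_formulaSeries]
    refine Fintype.sum_equiv (Equiv.arrowCongr (Equiv.refl (Fin s)) σ⁻¹) _ _ fun w => ?_
    simp [Equiv.arrowCongr]
  rw [hσ, sum_pow_eq_sum_words, Finset.smul_sum, Finset.smul_sum, ← Finset.sum_sub_distrib]
  simp only [sub_smul, mul_smul]

/-- The Taylor coefficient of the averaged error. Repetition-free words cancel; each remaining word
is estimated by the triangle inequality, with the coefficients of all factors replaced by `1`. Both
the evolution and the average contribute at most half of the bound. -/
theorem norm_average_error_coeff_le [DecidableEq ι] {B : Type*} [NormedRing B] [NormedAlgebra ℂ B]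
    (H : ι → B) {W : List (ℂ × ι)} (hnorm : ∀ p ∈ W, ‖p.1‖ ≤ 1)
    (hweight : ∀ i, letterWeight W i = 1)
    {m : ℕ} (hm : 1 ≤ m) (hlen : W.length = m * Fintype.card ι)
    (hcount : ∀ i, letterWeight (W.map fun p => ((1 : ℝ), p.2)) i = m)
    {Λ : ℝ} (hΛ : ∀ j, ‖H j‖ ≤ Λ) {s : ℕ} (hs : 2 ≤ s) :
    ‖(s ! : ℂ)⁻¹ • (∑ j, H j) ^ s - (((Fintype.card ι) ! : ℂ)⁻¹) •
        ∑ σ : Equiv.Perm ι, PowerSeries.coeff s (formulaSeries (fun j => H (σ j)) W)‖ ≤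
      (m * Λ) ^ s / ((s - 2) ! : ℝ) * (Fintype.card ι : ℝ) ^ (s - 1) := by
  set L := Fintype.card ι with hL
  set d : (Fin s → ι) → ℝ := fun w =>
    wordCoeff (W.map fun p => ((1 : ℝ), p.2)) (List.ofFn w) with hd
  set N : Finset (Fin s → ι) := Finset.univ.filter fun w => ¬ Function.Injective w with hN
  have hLpos : (0 : ℝ) < L ! := by exact_mod_cast L.factorial_pos
  have hspos : (0 : ℝ) < s ! := by exact_mod_cast s.factorial_pos
  -- The number of words with a repeated letter, and their total majorant weight.
  have hcard : (N.card : ℝ) = (L : ℝ) ^ s - L.descFactorial s := by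
    have h := Finset.card_filter_add_card_filter_not (s := (Finset.univ : Finset (Fin s → ι)))
      (fun w => Function.Injective w)
    rw [card_injective, Finset.card_univ, Fintype.card_fun, Fintype.card_fin] at h
    rw [eq_sub_iff_add_eq', hN]
    exact_mod_cast h
  have hweightN : ∑ w ∈ N, d w =
      (m : ℝ) ^ s / s ! * ((L : ℝ) ^ s - L.descFactorial s) := by
    have h := Finset.sum_filter_add_sum_filter_not (Finset.univ : Finset (Fin s → ι))
      (fun w => Function.Injective w) d
    have htot : ∑ w, d w = ((m : ℝ) * L) ^ s / s ! := by
      have h := sum_wordCoeff_one (W.map Prod.snd) s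
      rw [List.map_map, List.length_map, hlen, Nat.cast_mul] at h
      exact h
    have hchoose : (L.choose s : ℝ) = L.descFactorial s / s ! := by
      rw [Nat.descFactorial_eq_factorial_mul_choose, Nat.cast_mul, mul_div_cancel_left₀ _ hspos.ne']
    rw [htot, sum_wordCoeff_injective_of_weight hcount, ← hL, hchoose] at h
    rw [hN, ← sub_eq_iff_eq_add'.2 h.symm, mul_pow]
    ring
  have hperm : ∀ σ : Equiv.Perm ι, ∑ w ∈ N, d (fun i => σ (w i)) = ∑ w ∈ N, d w := fun σ => by
    rw [hN, Finset.sum_filter, Finset.sum_filter]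
    exact Fintype.sum_equiv (Equiv.arrowCongr (Equiv.refl (Fin s)) σ) _ _ fun v =>
      if_congr (not_congr (σ.injective.of_comp_iff v).symm) rfl rfl
  have hword : ∀ w : Fin s → ι, ‖(List.ofFn fun i => H (w i)).prod‖ ≤ Λ ^ s := fun w => by
    refine (List.norm_prod_le' ?_).trans ?_
    · rw [Ne, List.ofFn_eq_nil_iff]
      omega
    · rw [List.map_ofFn, List.prod_ofFn]
      refine (Finset.prod_le_prod (fun _ _ => norm_nonneg _) fun i _ => hΛ (w i)).trans ?_
      simp
  have hΛ0 : 0 ≤ Λ ^ s ∨ IsEmpty ι := by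
    rcases isEmpty_or_nonempty ι with h | ⟨⟨j⟩⟩
    · exact Or.inr h
    · exact Or.inl (pow_nonneg ((norm_nonneg _).trans (hΛ j)) s)
  rw [average_error_coeff, ← hL]
  -- Without letters nothing bounds `Λ` from below, but there are no words either.
  rcases hΛ0 with hΛ0 | hempty
  swap
  · have : IsEmpty (Fin s → ι) := ⟨fun w => hempty.false (w ⟨0, by omega⟩)⟩
    have hL0 : L = 0 := by simp [hL]
    rw [Finset.univ_eq_empty, Finset.sum_empty, norm_zero, hL0, Nat.cast_zero,
      zero_pow (by omega), mul_zero]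
  have hterm : ∀ w : Fin s → ι, ‖((s ! : ℂ)⁻¹ - (L ! : ℂ)⁻¹ *
      ∑ σ : Equiv.Perm ι, wordCoeff W (List.ofFn fun i => σ (w i))) •
        (List.ofFn fun i => H (w i)).prod‖ ≤
      if ¬ Function.Injective w then
        ((s ! : ℝ)⁻¹ + (L ! : ℝ)⁻¹ * ∑ σ : Equiv.Perm ι, d (fun i => σ (w i))) * Λ ^ s else 0 := by
    intro w
    by_cases hw : Function.Injective w
    · rw [if_neg (not_not.2 hw), sum_perm_wordCoeff hweight hw, ← hL, inv_mul_cancel_left₀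
        (by exact_mod_cast hLpos.ne'), sub_self, zero_smul, norm_zero]
    · rw [if_pos hw, norm_smul]
      refine mul_le_mul ((norm_sub_le _ _).trans (add_le_add ?_ ?_)) (hword w) (norm_nonneg _) ?_
      · simp
      · rw [norm_mul, norm_inv, RCLike.norm_natCast]
        exact mul_le_mul_of_nonneg_left ((norm_sum_le _ _).trans
          (Finset.sum_le_sum fun σ _ => norm_wordCoeff_le hnorm _)) (by positivity)
      · refine add_nonneg (by positivity) (mul_nonneg (by positivity)
          (Finset.sum_nonneg fun σ _ => ?_))
        exact (norm_nonneg _).trans (norm_wordCoeff_le hnorm _)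
  refine (norm_sum_le _ _).trans ((Finset.sum_le_sum fun w _ => hterm w).trans ?_)
  rw [← Finset.sum_filter, ← hN, ← Finset.sum_mul, Finset.sum_add_distrib, ← Finset.mul_sum,
    Finset.sum_comm, Finset.sum_congr rfl fun σ _ => hperm σ, Finset.sum_const, Finset.sum_const,
    Finset.card_univ, Fintype.card_perm, ← hL, nsmul_eq_mul, nsmul_eq_mul,
    inv_mul_cancel_left₀ hLpos.ne', hcard, hweightN]
  have hdeg := pow_sub_descFactorial_le L s
  have hdeg0 : 0 ≤ (L : ℝ) ^ s - L.descFactorial s := by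
    rw [← hcard]
    positivity
  have hm1 : (1 : ℝ) ≤ (m : ℝ) ^ s := one_le_pow₀ (by exact_mod_cast hm)
  obtain ⟨t, rfl⟩ : ∃ t, s = t + 2 := ⟨s - 2, by omega⟩
  have hfac : ((t + 2) ! : ℝ) = (t + 2) * (t + 1) * t ! := by
    rw [Nat.factorial_succ, Nat.factorial_succ]
    push_cast
    ring
  have ht : (0 : ℝ) < t ! := by exact_mod_cast t.factorial_pos
  rw [Nat.add_sub_cancel]
  set R := (L : ℝ) ^ (t + 2) - L.descFactorial (t + 2) with hR
  calc (R * ((t + 2) ! : ℝ)⁻¹ + (m : ℝ) ^ (t + 2) / (t + 2) ! * R) * Λ ^ (t + 2)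
      = (1 + (m : ℝ) ^ (t + 2)) * (R / (t + 2) !) * Λ ^ (t + 2) := by ring
    _ ≤ (2 * (m : ℝ) ^ (t + 2)) *
        ((((t + 2 : ℕ) : ℝ) * ((t + 2 : ℕ) - 1) / 2 * (L : ℝ) ^ (t + 2 - 1)) / (t + 2) !) *
          Λ ^ (t + 2) := by
        gcongr
        linarith
    _ = (m * Λ) ^ (t + 2) / (t ! : ℝ) * (L : ℝ) ^ (t + 2 - 1) := by
        rw [hfac]
        push_cast
        have h1 : (t : ℝ) + 2 ≠ 0 := by positivity
        have h2 : (t : ℝ) + 1 ≠ 0 := by positivity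
        rw [show (t : ℝ) + 2 - 1 = t + 1 by ring]
        field_simp
        ring

end Bound

/-! ### Entire functions with values in a Banach algebra -/

section Analytic

variable {B : Type*} [NormedRing B] [NormedAlgebra ℂ B]

/-- `f` is the sum of the everywhere absolutely convergent power series with coefficients `a`. -/
structure HasEntireSeries (f : ℂ → B) (a : ℕ → B) : Prop where
  summable : ∀ z : ℂ, Summable fun n => ‖z ^ n • a n‖
  hasSum : ∀ z : ℂ, HasSum (fun n => z ^ n • a n) (f z)

namespace HasEntireSeries

variable {f g : ℂ → B} {a b : ℕ → B}

theorem exp [CompleteSpace B] (A : B) :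
    HasEntireSeries (fun z => NormedSpace.exp (z • A))
      fun n => PowerSeries.coeff n (expSeries ℂ A) := by
  have h : ∀ (z : ℂ) (n : ℕ), z ^ n • PowerSeries.coeff n (expSeries ℂ A) =
      ((n ! : ℂ)⁻¹) • (z • A) ^ n := fun z n => by
    rw [coeff_expSeries, smul_pow, smul_comm]
  refine ⟨fun z => ?_, fun z => ?_⟩ <;> simp only [h]
  · exact NormedSpace.norm_expSeries_summable' _
  · exact NormedSpace.exp_series_hasSum_exp' _

theorem one : HasEntireSeries (fun _ => (1 : B))
    fun n => PowerSeries.coeff n (1 : PowerSeries B) := by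
  have h : ∀ n : ℕ, n ∉ ({0} : Finset ℕ) → PowerSeries.coeff n (1 : PowerSeries B) = 0 :=
    fun n hn => by
      rw [PowerSeries.coeff_one, if_neg (by simpa using hn)]
  refine ⟨fun z => summable_of_ne_finset_zero (s := {0}) fun n hn => by simp [h n hn],
    fun z => ?_⟩
  simpa using hasSum_sum_of_ne_finset_zero (s := {0})
    (f := fun n => z ^ n • PowerSeries.coeff n (1 : PowerSeries B)) fun n hn => by simp [h n hn]

theorem mul [CompleteSpace B] {P Q : PowerSeries B}
    (hf : HasEntireSeries f fun n => PowerSeries.coeff n P)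
    (hg : HasEntireSeries g fun n => PowerSeries.coeff n Q) :
    HasEntireSeries (fun z => f z * g z) fun n => PowerSeries.coeff n (P * Q) := by
  have h : ∀ (z : ℂ) (n : ℕ), z ^ n • PowerSeries.coeff n (P * Q) =
      ∑ p ∈ Finset.HasAntidiagonal.antidiagonal n,
        (z ^ p.1 • PowerSeries.coeff p.1 P) * (z ^ p.2 • PowerSeries.coeff p.2 Q) := fun z n => by
    rw [PowerSeries.coeff_mul, Finset.smul_sum]
    refine Finset.sum_congr rfl fun p hp => ?_
    rw [Finset.HasAntidiagonal.mem_antidiagonal] at hp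
    rw [smul_mul_smul_comm, ← pow_add, hp]
  have hsum : ∀ z : ℂ, Summable fun n => ‖z ^ n • PowerSeries.coeff n (P * Q)‖ := fun z => by
    have hs := summable_norm_sum_mul_antidiagonal_of_summable_norm
      (f := fun n => z ^ n • PowerSeries.coeff n P) (g := fun n => z ^ n • PowerSeries.coeff n Q)
      (hf.summable z) (hg.summable z)
    simpa only [← h] using hs
  refine ⟨hsum, fun z => ?_⟩
  have ht := tsum_mul_tsum_eq_tsum_sum_antidiagonal_of_summable_norm
    (f := fun n => z ^ n • PowerSeries.coeff n P) (g := fun n => z ^ n • PowerSeries.coeff n Q)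
    (hf.summable z) (hg.summable z)
  simp only [← h] at ht
  rw [(hf.hasSum z).tsum_eq, (hg.hasSum z).tsum_eq] at ht
  rw [ht]
  exact (hsum z).of_norm.hasSum

theorem const_smul (hf : HasEntireSeries f a) (c : ℂ) :
    HasEntireSeries (fun z => c • f z) fun n => c • a n := by
  refine ⟨fun z => ?_, fun z => ?_⟩ <;> simp only [smul_comm _ c]
  · simpa only [norm_smul] using (hf.summable z).mul_left ‖c‖
  · exact (hf.hasSum z).const_smul c

theorem sub (hf : HasEntireSeries f a) (hg : HasEntireSeries g b) :
    HasEntireSeries (fun z => f z - g z) fun n => a n - b n := by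
  refine ⟨fun z => ?_, fun z => ?_⟩ <;> simp only [smul_sub]
  · exact Summable.of_nonneg_of_le (fun _ => norm_nonneg _) (fun _ => norm_sub_le _ _)
      ((hf.summable z).add (hg.summable z))
  · exact (hf.hasSum z).sub (hg.hasSum z)

theorem sum {κ : Type*} (S : Finset κ) {F : κ → ℂ → B} {c : κ → ℕ → B}
    (h : ∀ i ∈ S, HasEntireSeries (F i) (c i)) :
    HasEntireSeries (fun z => ∑ i ∈ S, F i z) fun n => ∑ i ∈ S, c i n := by
  refine ⟨fun z => ?_, fun z => ?_⟩ <;> simp only [Finset.smul_sum]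
  · exact Summable.of_nonneg_of_le (fun _ => norm_nonneg _) (fun _ => norm_sum_le _ _)
      (summable_sum fun i hi => (h i hi).summable z)
  · exact hasSum_sum fun i hi => (h i hi).hasSum z

/-- The one-variable formal multilinear series with coefficients `a`. -/
def multilinearSeries (a : ℕ → B) : FormalMultilinearSeries ℂ ℂ B :=
  fun n => ContinuousMultilinearMap.mkPiRing ℂ (Fin n) (a n)

theorem hasFPowerSeriesOnBall (hf : HasEntireSeries f a) :
    HasFPowerSeriesOnBall f (multilinearSeries a) 0 ⊤ where
  r_le := by
    rw [top_le_iff]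
    refine FormalMultilinearSeries.radius_eq_top_of_summable_norm _ fun r => ?_
    refine (hf.summable (r : ℝ)).congr fun n => ?_
    rw [multilinearSeries, ContinuousMultilinearMap.norm_mkPiRing, norm_smul, norm_pow,
      Complex.norm_real, Real.norm_of_nonneg r.coe_nonneg, mul_comm]
  r_pos := ENNReal.zero_lt_top
  hasSum {y} _ := by simpa [multilinearSeries] using hf.hasSum y

theorem differentiable [CompleteSpace B] (hf : HasEntireSeries f a) : Differentiable ℂ f := by
  have h := hf.hasFPowerSeriesOnBall.differentiableOn
  rwa [Metric.eball_top, differentiableOn_univ] at h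

theorem taylorTerm_eq [CompleteSpace B] (hf : HasEntireSeries f a) (s : ℕ) (z : ℂ) :
    taylorTerm f s z = z ^ s • a s := by
  have h := hf.hasFPowerSeriesOnBall.factorial_smul 1 s
  rw [taylorTerm, iteratedDeriv_eq_iteratedFDeriv, ← h, ← Nat.cast_smul_eq_nsmul ℂ, smul_smul,
    div_mul_cancel₀ _ (by exact_mod_cast s.factorial_ne_zero)]
  simp [multilinearSeries]

end HasEntireSeries

theorem hasEntireSeries_prod_exp [CompleteSpace B] {ι : Type*} (H : ι → B) (W : List (ℂ × ι)) :
    HasEntireSeries (fun z => (W.map fun p => NormedSpace.exp ((p.1 * z) • H p.2)).prod)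
      fun n => PowerSeries.coeff n (formulaSeries H W) := by
  induction W with
  | nil => simpa using HasEntireSeries.one
  | cons p W ih =>
    simp only [List.map_cons, List.prod_cons, formulaSeries_cons]
    have h := HasEntireSeries.exp (p.1 • H p.2)
    simp only [smul_smul, mul_comm _ p.1] at h
    exact h.mul ih

end Analytic

/-! ### Suzuki's formulas as lists of factors -/

section Suzuki

variable {L : ℕ}

/-- The factors `exp (q z H_j)` of the formula `S_{2k}`, listed from left to right as pairs
`(q, j)`. -/
def suzukiFactors (L : ℕ) : ℕ → List (ℂ × Fin L)
  | 0 => []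
  | 1 => (List.ofFn fun j => (1 / 2, j)) ++ (List.ofFn fun j => (1 / 2, j)).reverse
  | k + 2 =>
      let W := suzukiFactors L (k + 1)
      let p : ℂ := suzukiCoeff (k + 2)
      scaleFactors p W ++ scaleFactors p W ++ scaleFactors (1 - 4 * p) W ++
        scaleFactors p W ++ scaleFactors p W

theorem suzuki_eq_prod {E : Type*} [NormedAddCommGroup E] [InnerProductSpace ℂ E]
    (H : Fin L → E →L[ℂ] E) (σ : Equiv.Perm (Fin L)) (k : ℕ) (z : ℂ) :
    suzuki H σ (k + 1) z =
      ((suzukiFactors L (k + 1)).map fun p => NormedSpace.exp ((p.1 * z) • H (σ p.2))).prod := by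
  induction k generalizing z with
  | zero =>
    simp only [suzuki, secondOrder, suzukiFactors, List.map_append, List.prod_append,
      List.map_reverse, List.map_ofFn, Function.comp_def, one_div_mul_eq_div]
  | succ k ih =>
    have hscale : ∀ q : ℂ, suzuki H σ (k + 1) (q * z) =
        ((scaleFactors q (suzukiFactors L (k + 1))).map fun p =>
          NormedSpace.exp ((p.1 * z) • H (σ p.2))).prod := fun q => by
      rw [ih, scaleFactors, List.map_map]
      simp only [Function.comp_def]
      congr 2
      funext p
      rw [← mul_assoc, mul_comm p.1 q]
    rw [suzuki, suzukiFactors, hscale, hscale]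
    simp only [List.map_append, List.prod_append, pow_two, mul_assoc]

/-- The two properties that define Suzuki's coefficient: it cancels the leading error, and with
`1 / 3 < p < 1 / 2` all subintervals are shorter than the whole. -/
theorem suzukiCoeff_spec (k : ℕ) :
    4 * suzukiCoeff (k + 2) ^ (2 * (k + 1) + 1) +
        (1 - 4 * suzukiCoeff (k + 2)) ^ (2 * (k + 1) + 1) = 0 ∧
      |suzukiCoeff (k + 2)| ≤ 1 ∧ |1 - 4 * suzukiCoeff (k + 2)| ≤ 1 := by
  have hn : (2 * ((k + 2 : ℕ) : ℝ) - 1) = ((2 * (k + 1) + 1 : ℕ) : ℝ) := by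
    push_cast
    ring
  rw [suzukiCoeff, hn]
  set n := 2 * (k + 1) + 1 with hn'
  set x : ℝ := (4 : ℝ) ^ (1 / (n : ℝ)) with hx
  have hxn : x ^ n = 4 := by
    rw [hx, one_div]
    exact Real.rpow_inv_natCast_pow (by norm_num) (by omega)
  have hx1 : 1 ≤ x := Real.one_le_rpow (by norm_num) (by positivity)
  have hx2 : x < 2 := by
    by_contra! h
    have h8 : (2 : ℝ) ^ 3 ≤ x ^ n :=
      (pow_le_pow_right₀ one_le_two (by omega)).trans (pow_le_pow_left₀ zero_le_two h n)
    norm_num [hxn] at h8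
  have hx4 : (4 : ℝ) - x ≠ 0 := by linarith
  have hneg : 1 - 4 * (1 / (4 - x)) = -(x * (1 / (4 - x))) := by
    field_simp
    ring
  have hodd : Odd n := ⟨k + 1, rfl⟩
  have hp0 : 0 < 1 / (4 - x) := one_div_pos.2 (by linarith)
  have hp1 : 1 / (4 - x) ≤ 1 / 2 := one_div_le_one_div_of_le (by norm_num) (by linarith)
  refine ⟨?_, ?_, ?_⟩
  · rw [hneg, hodd.neg_pow, mul_pow, hxn]
    ring
  · rw [abs_of_pos hp0]
    linarith
  · rw [hneg, abs_neg, abs_of_nonneg (by positivity)]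
    nlinarith

theorem reverse_suzukiFactors (k : ℕ) :
    (suzukiFactors L (k + 1)).reverse = suzukiFactors L (k + 1) := by
  induction k with
  | zero => simp [suzukiFactors]
  | succ k ih =>
    simp only [suzukiFactors, List.reverse_append, scaleFactors, ← List.map_reverse, ih,
      List.append_assoc]

theorem norm_le_one_of_mem_suzukiFactors (k : ℕ) :
    ∀ p ∈ suzukiFactors L (k + 1), ‖p.1‖ ≤ 1 := by
  induction k with
  | zero =>
    intro p hp
    simp only [suzukiFactors, List.mem_append, List.mem_reverse, or_self, List.mem_ofFn] at hp
    obtain ⟨j, rfl⟩ := hp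
    norm_num
  | succ k ih =>
    have hscale : ∀ q : ℝ, |q| ≤ 1 →
        ∀ p ∈ scaleFactors (q : ℂ) (suzukiFactors L (k + 1)), ‖p.1‖ ≤ 1 := fun q hq p hp => by
      obtain ⟨p', hp', rfl⟩ := List.mem_map.1 hp
      rw [norm_mul, Complex.norm_real]
      exact mul_le_one₀ hq (norm_nonneg _) (ih p' hp')
    have h1 := hscale _ (suzukiCoeff_spec k).2.1
    have h2 := hscale _ (suzukiCoeff_spec k).2.2
    push_cast at h2
    intro p hp
    simp only [suzukiFactors, List.mem_append] at hp
    rcases hp with (((hp | hp) | hp) | hp) | hp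
    exacts [h1 p hp, h1 p hp, h2 p hp, h1 p hp, h1 p hp]

theorem letterWeight_append {K ι : Type*} [Field K] [DecidableEq ι] (W W' : List (K × ι)) (i : ι) :
    letterWeight (W ++ W') i = letterWeight W i + letterWeight W' i := by
  simp [letterWeight]

theorem letterWeight_reverse {K ι : Type*} [Field K] [DecidableEq ι] (W : List (K × ι)) (i : ι) :
    letterWeight W.reverse i = letterWeight W i := by
  rw [letterWeight, List.map_reverse, List.sum_reverse, letterWeight]

theorem letterWeight_scaleFactors {K ι : Type*} [Field K] [DecidableEq ι] (q : K)
    (W : List (K × ι)) (i : ι) : letterWeight (scaleFactors q W) i = q * letterWeight W i := by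
  rw [letterWeight, letterWeight, scaleFactors, List.map_map, ← List.sum_map_mul_left]
  simp [Function.comp_def]

theorem letterWeight_ofFn {K : Type*} [Field K] (q : K) (i : Fin L) :
    letterWeight (List.ofFn fun j : Fin L => (q, j)) i = q := by
  simp [letterWeight, List.map_ofFn, List.sum_ofFn]

theorem letterWeight_suzukiFactors (k : ℕ) (i : Fin L) :
    letterWeight (suzukiFactors L (k + 1)) i = 1 := by
  induction k with
  | zero =>
    rw [suzukiFactors, letterWeight_append, letterWeight_reverse, letterWeight_ofFn]
    norm_num
  | succ k ih =>
    simp only [suzukiFactors, letterWeight_append, letterWeight_scaleFactors, ih]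
    ring

theorem map_one_scaleFactors {K ι : Type*} [Field K] (q : K) (W : List (K × ι)) :
    ((scaleFactors q W).map fun p => ((1 : ℝ), p.2)) = W.map fun p => ((1 : ℝ), p.2) := by
  simp [scaleFactors, Function.comp_def]

/-- Each summand occurs in `2 * 5 ^ (k - 1)` of the exponentials of the formula `S_{2k}`. -/
theorem letterWeight_map_one_suzukiFactors (k : ℕ) (i : Fin L) :
    letterWeight ((suzukiFactors L (k + 1)).map fun p => ((1 : ℝ), p.2)) i =
      ((2 * 5 ^ k : ℕ) : ℝ) := by
  induction k with
  | zero =>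
    simp only [suzukiFactors, List.map_append, List.map_reverse, List.map_ofFn,
      Function.comp_def, letterWeight_append, letterWeight_reverse, letterWeight_ofFn]
    norm_num
  | succ k ih =>
    simp only [suzukiFactors, List.map_append, map_one_scaleFactors, letterWeight_append, ih]
    push_cast
    ring

theorem length_suzukiFactors (k : ℕ) :
    (suzukiFactors L (k + 1)).length = 2 * 5 ^ k * L := by
  induction k with
  | zero =>
    simp [suzukiFactors]
    ring
  | succ k ih =>
    simp only [suzukiFactors, List.length_append, scaleFactors, List.length_map, ih]
    ring

/-- Suzuki's order condition: `S_{2k}` agrees with the exponential through order `2k`. -/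
theorem eqToOrder_suzukiFactors {B : Type*} [Ring B] [Algebra ℂ B] (H : Fin L → B) (k : ℕ) :
    ∃ r, EqToOrder (2 * (k + 1) + 1) (formulaSeries H (suzukiFactors L (k + 1)))
      (expSeries ℂ (∑ j, H j)) r := by
  induction k with
  | zero =>
    have hone := eqToOrder_formulaSeries_one H (suzukiFactors L 1)
    have hsum : ((suzukiFactors L 1).map fun p => p.1 • H p.2).sum = ∑ j, H j := by
      simp only [suzukiFactors, List.map_append, List.map_reverse, List.map_ofFn,
        Function.comp_def, List.sum_append, List.sum_reverse, List.sum_ofFn]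
      rw [← Finset.sum_add_distrib]
      refine Finset.sum_congr rfl fun j _ => ?_
      rw [← add_smul, add_halves, one_smul]
    have h1 : EqToOrder 1 (formulaSeries H (suzukiFactors L 1)) (expSeries ℂ (∑ j, H j)) 0 := by
      refine ⟨one_pos, hone.left_one, by simp, fun m hm => ?_, ?_⟩
      · obtain rfl : m = 0 := by omega
        rw [hone.left_one]
        simp
      · rw [hone.leading, hsum]
        simp [PowerSeries.coeff_one]
    have h2 := h1.succ
    have hz := h2.eq_zero_of_even even_two
      (formulaSeries_mul_dilate_neg H (reverse_suzukiFactors 0))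
    rw [hz] at h2
    exact ⟨_, h2.succ⟩
  | succ k ih =>
    obtain ⟨r, hr⟩ := ih
    exact hr.suzukiStep (reverse_suzukiFactors k) (by exact_mod_cast (suzukiCoeff_spec k).1)

/-- The Taylor expansion of the averaged error in terms of formal product formulas. -/
theorem hasEntireSeries_averageError {E : Type*} [NormedAddCommGroup E] [InnerProductSpace ℂ E]
    [FiniteDimensional ℂ E] (H : Fin L → E →L[ℂ] E) (k : ℕ) :
    HasEntireSeries (averageError H (k + 1)) fun n =>
      (n ! : ℂ)⁻¹ • (∑ j, H j) ^ n - (((Fintype.card (Fin L)) ! : ℂ)⁻¹) •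
        ∑ σ : Equiv.Perm (Fin L), PowerSeries.coeff n
          (formulaSeries (fun j => H (σ j)) (suzukiFactors L (k + 1))) := by
  have : CompleteSpace E := FiniteDimensional.complete ℂ E
  have h1 := HasEntireSeries.exp (∑ j, H j)
  have h2 := HasEntireSeries.sum (Finset.univ : Finset (Equiv.Perm (Fin L))) fun σ _ =>
    hasEntireSeries_prod_exp (fun j => H (σ j)) (suzukiFactors L (k + 1))
  have h := h1.sub (h2.const_smul ((L ! : ℂ)⁻¹))
  simp only [coeff_expSeries, ← suzuki_eq_prod] at h
  rw [Fintype.card_fin]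
  exact h

end Suzuki

end ProductFormula

end

theorem lemma3 {E : Type*} [NormedAddCommGroup E] [InnerProductSpace ℂ E]
    [FiniteDimensional ℂ E] {L : ℕ} (H : Fin L → E →L[ℂ] E)
    (hH : ∀ j, (H j : E →ₗ[ℂ] E).IsSymmetric) (z : ℂ) (k s : ℕ) (hk : 1 ≤ k) :
    Differentiable ℂ (ProductFormula.averageError H k) ∧
    (s ≤ 2 * k →
      ProductFormula.taylorTerm (ProductFormula.averageError H k) s z = 0) ∧
    (2 * k < s →
      ‖ProductFormula.taylorTerm (ProductFormula.averageError H k) s z‖ ≤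
        (2 * 5 ^ (k - 1) * (⨆ j, ‖H j‖) * ‖z‖) ^ s / ((s - 2) ! : ℝ) *
          (L : ℝ) ^ (s - 1)) := by
  have : CompleteSpace E := FiniteDimensional.complete ℂ E
  obtain ⟨k, rfl⟩ : ∃ i, k = i + 1 := ⟨k - 1, by omega⟩
  have hf := ProductFormula.hasEntireSeries_averageError H k
  refine ⟨hf.differentiable, fun hs => ?_, fun hs => ?_⟩
  · -- Each ordering separately satisfies the order condition, for one and the same exponential.
    have hσ : ∀ σ : Equiv.Perm (Fin L), PowerSeries.coeff s (ProductFormula.formulaSeries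
        (fun j => H (σ j)) (ProductFormula.suzukiFactors L (k + 1))) =
          (s ! : ℂ)⁻¹ • (∑ j, H j) ^ s := fun σ => by
      obtain ⟨r, hr⟩ := ProductFormula.eqToOrder_suzukiFactors (fun j => H (σ j)) k
      rw [hr.lower s (by omega), ProductFormula.coeff_expSeries, Equiv.sum_comp σ H]
    have hL : ((Fintype.card (Fin L)) ! : ℂ) ≠ 0 := by exact_mod_cast Nat.factorial_ne_zero _
    rw [hf.taylorTerm_eq, Finset.sum_congr rfl fun σ _ => hσ σ, Finset.sum_const, Finset.card_univ,
      Fintype.card_perm, ← Nat.cast_smul_eq_nsmul ℂ, inv_smul_smul₀ hL, sub_self, smul_zero]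
  · have hb := ProductFormula.norm_average_error_coeff_le H
      (ProductFormula.norm_le_one_of_mem_suzukiFactors k)
      (ProductFormula.letterWeight_suzukiFactors k) (m := 2 * 5 ^ k)
      (Nat.mul_pos two_pos (by positivity))
      (by rw [ProductFormula.length_suzukiFactors, Fintype.card_fin])
      (ProductFormula.letterWeight_map_one_suzukiFactors k)
      (fun j => le_ciSup (f := fun j => ‖H j‖) (Set.finite_range _).bddAbove j)
      (s := s) (by omega)
    rw [hf.taylorTerm_eq, norm_smul, norm_pow]
    refine (mul_le_mul_of_nonneg_left hb (by positivity)).trans_eq ?_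
    rw [Fintype.card_fin, Nat.add_sub_cancel]
    push_cast
    ring
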